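/- Let $f,g:S^2\to S^2$ be post-critically finite branched coverings: continuous maps that near every point are of the form $z\mapsto z^k$, $k\ge 1$, in suitable topological charts centred at the point and at its image, and whose post-critical sets $P_f=\bigcup_{n\ge 1}f^n(C_f)$, $P_g=\bigcup_{n\ge 1}g^n(C_g)$ are finite, where $C_f$ (resp. $C_g$) is the set of critical points, i.e. points at which the map is not a local homeomorphism. For $t\in S^2\setminus P_f$, the tree of preimages $T(f,t)$ has as vertices the disjoint union $\bigsqcup_{n\ge 0}f^{-n}(t)$ and as edges the pairs $\{f(x),x\}$ with $x\in f^{-(n+1)}(t)$, $f(x)\in f^{-n}(t)$. The group $\pi_1(S^2\setminus P_f,t)$ acts on the vertices by the monodromy action $\Phi_f$: on level $n$, $[\gamma]x$ is the end point of the $f^n$-lift of $\gamma$ starting at $x$. The iterated monodromy group is $\mathrm{IMG}(f,t)=\pi_1(S^2\setminus P_f,t)/\operatorname{Ker}\Phi_f$. The same notions are used for $g$. Suppose that $f$ and $g$ are combinatorially (Thurston) equivalent via orientation-preserving homeomorphisms $\psi_0,\psi_1$ of $S^2$, that is, $\psi_0\circ f=g\circ\psi_1$, $\psi_0(P_f)=\psi_1(P_f)=P_g$,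 $\psi_0|_{P_f}=\psi_1|_{P_f}$, and $\psi_0$ is isotopic to $\psi_1$ relatively to $P_f$. Then for every $t\in S^2\setminus P_f$: 1. the push-forward $(\psi_0)_\star:\pi_1(S^2\setminus P_f,t)\to\pi_1(S^2\setminus P_g,\psi_0(t))$, $[\gamma]\mapsto[\psi_0\circ\gamma]$, is bijective and maps $\operatorname{Ker}\Phi_f$ onto $\operatorname{Ker}\Phi_g$, so that it induces a group isomorphism from $\mathrm{IMG}(f,t)$ onto $\mathrm{IMG}(g,\psi_0(t))$, $[\gamma]\operatorname{Ker}\Phi_f\mapsto[\psi_0\circ\gamma]\operatorname{Ker}\Phi_g$; that is, $(\psi_0)_\star(\mathrm{IMG}(f,t))=\mathrm{IMG}(g,\psi_0(t))$; 2. more precisely, there is an isomorphism of rooted trees $\tau:T(f,t)\to T(g,\psi_0(t))$ such that $[\psi_0\circ\gamma]\,\tau(v)=\tau([\gamma]v)$ for every loop $\gamma$ in $S^2\setminus P_f$ based at $t$ and every vertex $v$ of $T(f,t)$. Consequently the iterated monodromy group is an invariant of combinatorial equivalence classes: $\mathrm{IMG}(f,t)\cong\mathrm{IMG}(g,s)$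 for all base points $t\in S^2\setminus P_f$ and $s\in S^2\setminus P_g$. -/

import Mathlib

open CategoryTheory

namespace ThurstonMap

noncomputable section

/-- The topological sphere `S²`. -/
abbrev S2 : Type := Metric.sphere (0 : EuclideanSpace ℝ (Fin 3)) 1

/-! ### Post-critically finite branched coverings of the sphere -/

/-- A branched covering of the (compact) sphere: a continuous map which, near every point `x`, is
`z ↦ z ^ k` for some `k ≥ 1` in suitable topological charts centred at `x` and at `f x`. -/
def IsBranchedCovering (f : S2 → S2) : Prop :=
  Continuous f ∧ ∀ x : S2, ∃ (k : ℕ) (φ ψ : OpenPartialHomeomorph S2 ℂ),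
    0 < k ∧ x ∈ φ.source ∧ f x ∈ ψ.source ∧ φ x = 0 ∧ ψ (f x) = 0 ∧
      Set.MapsTo f φ.source ψ.source ∧ ∀ y ∈ φ.source, ψ (f y) = φ y ^ k

/-- The critical points: the points near which `f` is not a local homeomorphism. -/
def criticalSet (f : S2 → S2) : Set S2 := {x | ¬ IsLocalHomeomorphOn f {x}}

/-- The post-critical set `P_f = ⋃_{n ≥ 1} fⁿ(C_f)`, where `C_f` is the set of critical points. -/
def postCriticalSet (f : S2 → S2) : Set S2 :=
  ⋃ n : ℕ, f^[n + 1] '' criticalSet f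

/-- Post-critically finite branched coverings of the sphere. -/
structure PCFBranchedCovering where
  toFun : S2 → S2
  isBranchedCovering : IsBranchedCovering toFun
  finite_postCriticalSet : (postCriticalSet toFun).Finite

namespace PCFBranchedCovering

instance : CoeFun PCFBranchedCovering (fun _ => S2 → S2) := ⟨toFun⟩

variable (f : PCFBranchedCovering)

/-- The post-critical set `P_f`. -/
abbrev P : Set S2 := postCriticalSet f

/-- The base `M = S² \ P_f` of the partial self-covering induced by `f`. -/
abbrev M : Set S2 := f.Pᶜ

theorem iterate_isLocalHomeomorphOn (n : ℕ) :
    IsLocalHomeomorphOn f^[n] (f^[n] ⁻¹' f.M) := by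
  induction n with
  | zero =>
    exact (Homeomorph.refl S2).isLocalHomeomorph.isLocalHomeomorphOn
  | succ n ih =>
    refine IsLocalHomeomorphOn.comp ih (t := f^[n] ⁻¹' f.M) ?_ (fun x hx => hx)
    intro x hx
    by_contra hcon
    refine hx (Set.mem_iUnion.2 ⟨n, x, fun h => hcon (h x rfl), rfl⟩)

/-- `fⁿ : M_n = f⁻ⁿ(M) → M`. -/
def iter (n : ℕ) : f^[n] ⁻¹' f.M → f.M := f.M.restrictPreimage f^[n]

theorem iter_isCoveringMap (n : ℕ) : IsCoveringMap (f.iter n) :=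
  (IsCoveringMapOn.of_isLocalHomeomorphOn (f.isBranchedCovering.1.iterate n)
    (f.iterate_isLocalHomeomorphOn n)).isCoveringMap_restrictPreimage

/-! ### The tree of preimages and the iterated monodromy group -/

/-- The vertices of the tree of preimages `T(f, t)`: the disjoint union over `n ≥ 0` of the
fibres `f⁻ⁿ(t)`. -/
abbrev Vertex (t : f.M) : Type := Σ n : ℕ, (f.iter n ⁻¹' {t} : Set (f^[n] ⁻¹' f.M))

variable {f} in
/-- The level of a vertex. -/
def Vertex.level {t : f.M} (v : f.Vertex t) : ℕ := v.1

variable {f} in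
/-- The point of the sphere underlying a vertex. -/
def Vertex.point {t : f.M} (v : f.Vertex t) : S2 := v.2.1.1

variable {f} in
/-- `v` is the parent of `w`: `w` lies one level further and `f` maps `w` to `v`. -/
def Vertex.IsParent {t : f.M} (v w : f.Vertex t) : Prop :=
  w.level = v.level + 1 ∧ f w.point = v.point

/-- The tree of preimages `T(f, t)`, as a graph. -/
def tree (t : f.M) : SimpleGraph (f.Vertex t) where
  Adj v w := v.IsParent w ∨ w.IsParent v
  symm := ⟨fun _ _ h => h.symm⟩
  loopless := ⟨fun v h => by
    have h' : v.IsParent v := h.elim id id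
    have := h'.1
    omega⟩

/-- The monodromy action `Φ : π₁(S² \ P_f, t) → Sym (⨆ₙ f⁻ⁿ(t))`: on level `n` a class `[γ]` sends
`x` to the end point of the `fⁿ`-lift of `γ` that starts at `x`. -/
def monodromy (t : f.M) : FundamentalGroup f.M t →* Equiv.Perm (f.Vertex t) :=
  (Equiv.Perm.sigmaCongrRightHom fun n : ℕ => (f.iter n ⁻¹' {t} : Set (f^[n] ⁻¹' f.M))).comp
    (MonoidHom.pi fun n => (f.iter_isCoveringMap n).monodromyPerm t)

/-- The iterated monodromy group `IMG(f, t) = π₁(S² \ P_f, t) / Ker Φ`. -/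
abbrev IMG (t : f.M) : Type := FundamentalGroup f.M t ⧸ (f.monodromy t).ker

end PCFBranchedCovering

/-- Isomorphisms of rooted trees between trees of preimages: bijections of the vertices that
preserve levels and edges. -/
structure TreeIso (f g : PCFBranchedCovering) (t : f.M) (s : g.M)
    extends f.tree t ≃g g.tree s where
  level_eq : ∀ v : f.Vertex t, (toEquiv v).level = v.level

/-! ### Combinatorial (Thurston) equivalence -/

/-- A homeomorphism of the sphere is orientation preserving if it acts trivially on the top
singular homology group `H₂(S²; ℤ)`. -/
def OrientationPreserving (ψ : S2 ≃ₜ S2) : Prop :=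
  ((AlgebraicTopology.singularHomologyFunctor (ModuleCat.{0} ℤ) 2).obj (ModuleCat.of ℤ ℤ)).map
    (TopCat.ofHom (ψ : C(S2, S2))) = 𝟙 _

/-- `ψ₀` is isotopic to `ψ₁` relatively to `A`: there is a homotopy through homeomorphisms, fixed
on `A`, from `ψ₀` to `ψ₁`. -/
def IsotopicRel (ψ₀ ψ₁ : S2 ≃ₜ S2) (A : Set S2) : Prop :=
  ∃ H : (ψ₀ : C(S2, S2)).HomotopyRel (ψ₁ : C(S2, S2)) A,
    ∀ s : unitInterval, IsHomeomorph fun x => H (s, x)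

/-- The pair `(ψ₀, ψ₁)` realizes a combinatorial equivalence between `f` and `g`. -/
structure IsCombinatorialEquivalence (f g : PCFBranchedCovering) (ψ₀ ψ₁ : S2 ≃ₜ S2) : Prop where
  orientationPreserving₀ : OrientationPreserving ψ₀
  orientationPreserving₁ : OrientationPreserving ψ₁
  comp_eq : ψ₀ ∘ f = g ∘ ψ₁
  image₀ : ψ₀ '' f.P = g.P
  image₁ : ψ₁ '' f.P = g.P
  eqOn : Set.EqOn ψ₀ ψ₁ f.P
  isotopic : IsotopicRel ψ₀ ψ₁ f.P

/-- The restriction `S² \ P_f → S² \ P_g` of a homeomorphism `ψ` with `ψ(P_f) = P_g`. -/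
def restrict {f g : PCFBranchedCovering} (ψ : S2 ≃ₜ S2) (h : ψ '' f.P = g.P) : C(f.M, g.M) where
  toFun x := ⟨ψ x, fun hx => by
    rw [← h] at hx
    obtain ⟨y, hy, hyx⟩ := hx
    exact x.2 (ψ.injective hyx ▸ hy)⟩
  continuous_toFun := by fun_prop

/-- The push-forward `ψ_⋆ : π₁(S² \ P_f, t) → π₁(S² \ P_g, ψ(t))`, `[γ] ↦ [ψ ∘ γ]`. -/
def pushForward {f g : PCFBranchedCovering} (ψ : S2 ≃ₜ S2) (h : ψ '' f.P = g.P) (t : f.M) :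
    FundamentalGroup f.M t →* FundamentalGroup g.M (restrict ψ h t) :=
  FundamentalGroup.map (restrict ψ h) t

end

end ThurstonMap

/-! Each stage of the isotopy from `ψ₀` to `ψ₁` carries `P_f` onto `P_g`, so the isotopy restricts
to the complements `M_f → M_g`. Since `g ∘ ψ₁ = ψ₀ ∘ f`, the homotopy precomposed with `f` lifts
through the covering `g`, starting at `ψ₁`; the end of the lift is a map `ψ₂` with `g ∘ ψ₂ = ψ₁ ∘
f`, and the process repeats (`LevelHomotopy.exists_lift`). The initial maps `θ n` of these
homotopies satisfy `θ 0 = ψ₀` and `g ∘ θ (n + 1) = θ n ∘ f`, hence `gⁿ ∘ θ n = ψ₀ ∘ fⁿ`. So the `θ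
n` are bijective on fibres and respect parents, which gives the tree isomorphism; naturality of
monodromy makes it equivariant, and the equality of kernels follows. Change of base point is
conjugation by a path, available because `M_g` is path connected. -/

/-- Monodromy is natural with respect to maps of covering spaces. -/
theorem IsCoveringMap.monodromy_naturality {E X E' X' : Type*} [TopologicalSpace E]
    [TopologicalSpace X] [TopologicalSpace E'] [TopologicalSpace X'] {p : E → X} {q : E' → X'}
    (hp : IsCoveringMap p) (hq : IsCoveringMap q) (φ : C(E, E')) (ψ : C(X, X'))
    (hφ : ∀ e, q (φ e) = ψ (p e)) {x y : X} (γ : Path.Homotopic.Quotient x y) (e : p ⁻¹' {x}) :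
    ((hq.monodromy (γ.map ψ) ⟨φ e, (hφ e).trans (congrArg ψ e.2)⟩).1 : E') =
      φ (hp.monodromy γ e).1 := by
  obtain ⟨γ⟩ := γ
  have h0 : γ 0 = p e := γ.source.trans e.2.symm
  -- By uniqueness of lifts, the image under `φ` of the lift of `γ` is the lift of `ψ ∘ γ`.
  refine congr($((hq.eq_liftPath_iff' (γ := (γ.map ψ.continuous : C(unitInterval, X')))
    (Γ := φ.comp (hp.liftPath γ e h0)) ?_).mpr ⟨?_, ?_⟩) 1).symm
  · simp [hφ, e.2.symm]
  · funext s
    simpa [hφ] using congrArg ψ (congrFun (hp.liftPath_lifts γ e h0) s)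
  · simp [hp.liftPath_zero γ e h0]

/-- A lift of a path through a covering map with a given end point. -/
theorem IsCoveringMap.exists_path_lifts_of_one {E X : Type*} [TopologicalSpace E]
    [TopologicalSpace X] {p : E → X} (hp : IsCoveringMap p) (γ : C(unitInterval, X)) (e : E)
    (he : γ 1 = p e) : ∃ Γ : C(unitInterval, E), p ∘ Γ = γ ∧ Γ 1 = e := by
  obtain ⟨Γ, hΓ, hΓ0⟩ := hp.exists_path_lifts
    (γ.comp ⟨unitInterval.symm, unitInterval.continuous_symm⟩) e (by simpa using he)
  refine ⟨Γ.comp ⟨unitInterval.symm, unitInterval.continuous_symm⟩, ?_, by simpa using hΓ0⟩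
  funext s
  simpa using congrFun hΓ (unitInterval.symm s)

/-- A homeomorphism induces bijections on homotopy classes of paths. -/
theorem Homeomorph.bijective_path_homotopic_map {X Y : Type*} [TopologicalSpace X]
    [TopologicalSpace Y] (φ : X ≃ₜ Y) (x y : X) :
    Function.Bijective fun γ : Path.Homotopic.Quotient x y ↦ γ.map (φ : C(X, Y)) := by
  constructor
  · rintro ⟨γ⟩ ⟨γ'⟩ h
    obtain ⟨F⟩ := Path.Homotopic.Quotient.exact h
    have key (δ : Path x y) : (φ.symm : C(Y, X)).comp (δ.map φ.continuous : C(unitInterval, Y)) =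
        (δ : C(unitInterval, X)) := by
      ext s
      simp
    exact Path.Homotopic.Quotient.eq.2
      ⟨(F.compContinuousMap (φ.symm : C(Y, X))).cast (key γ) (key γ')⟩
  rintro ⟨γ⟩
  refine ⟨.mk ((γ.map φ.symm.continuous).cast (φ.symm_apply_apply x).symm
    (φ.symm_apply_apply y).symm), congrArg Path.Homotopic.Quotient.mk ?_⟩
  ext s
  simp

/-- The complement of a finite subset of the sphere is path connected. -/
theorem isPathConnected_compl_of_finite_sphere
    {A : Set (Metric.sphere (0 : EuclideanSpace ℝ (Fin 3)) 1)}
    (hA : A.Finite) : IsPathConnected Aᶜ := by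
  rcases A.eq_empty_or_nonempty with rfl | ⟨v, hv⟩
  · rw [Set.compl_empty, ← pathConnectedSpace_iff_univ, ← isPathConnected_iff_pathConnectedSpace]
    refine isPathConnected_sphere ?_ 0 zero_le_one
    rw [← Module.finrank_eq_rank, finrank_euclideanSpace_fin]
    norm_num
  · have : Fact (Module.finrank ℝ (EuclideanSpace ℝ (Fin 3)) = 2 + 1) := ⟨by simp⟩
    -- Projecting from a point of `A` turns the complement into that of a finite subset of the
    -- plane.
    let e := stereographic' 2 v
    have ht : e.target = Set.univ := stereographic'_target v
    have hinj : Function.Injective e.symm := fun a b hab =>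
      e.symm.injOn (by simp [ht]) (by simp [ht]) hab
    have hcont : Continuous e.symm := by
      rw [← continuousOn_univ, ← ht]
      exact e.continuousOn_symm
    have hpre : IsPathConnected (e.symm ⁻¹' A)ᶜ := by
      refine (hA.preimage hinj.injOn).countable.isPathConnected_compl_of_one_lt_rank ?_
      rw [← Module.finrank_eq_rank, finrank_euclideanSpace_fin]
      norm_num
    convert hpre.image hcont using 1
    ext x
    constructor
    · intro hx
      have hxs : x ∈ e.source := by
        rw [stereographic'_source]
        rintro rfl
        exact hx hv
      refine ⟨e x, ?_, e.left_inv hxs⟩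
      simpa [e.left_inv hxs] using hx
    · rintro ⟨y, hy, rfl⟩
      exact hy

/-! ### The tower of coverings and change of base point -/

namespace ThurstonMap

namespace PCFBranchedCovering

variable (f : PCFBranchedCovering)

/-- Contrapositive of the forward invariance of `P_f`. -/
theorem preimage_M_subset : f ⁻¹' f.M ⊆ f.M := by
  intro x hx hxP
  obtain ⟨n, c, hc, rfl⟩ := Set.mem_iUnion.1 hxP
  exact hx (Set.mem_iUnion.2 ⟨n + 1, c, hc, Function.iterate_succ_apply' f (n + 1) c⟩)

theorem preimage_iterate_M_antitone (n : ℕ) : f^[n + 1] ⁻¹' f.M ⊆ f^[n] ⁻¹' f.M := by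
  intro x hx
  rw [Set.mem_preimage, Function.iterate_succ_apply'] at hx
  exact f.preimage_M_subset hx

theorem preimage_iterate_M_subset (n : ℕ) : f^[n] ⁻¹' f.M ⊆ f.M := by
  induction n with
  | zero => exact subset_rfl
  | succ n ih => exact (f.preimage_iterate_M_antitone n).trans ih

/-- The inclusion `f⁻⁽ⁿ⁺¹⁾(M) → f⁻ⁿ(M)`. -/
def incl (n : ℕ) : C(f^[n + 1] ⁻¹' f.M, f^[n] ⁻¹' f.M) where
  toFun := Set.inclusion (f.preimage_iterate_M_antitone n)
  continuous_toFun := continuous_inclusion _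

/-- The covering `f : f⁻⁽ⁿ⁺¹⁾(M) → f⁻ⁿ(M)`. -/
def levelMap (n : ℕ) : C(f^[n + 1] ⁻¹' f.M, f^[n] ⁻¹' f.M) where
  toFun x := ⟨f x, x.2⟩
  continuous_toFun := (f.isBranchedCovering.1.comp continuous_subtype_val).subtype_mk _

theorem levelMap_isCoveringMap (n : ℕ) : IsCoveringMap (f.levelMap n) := by
  have h : IsCoveringMapOn f^[1] f.M := IsCoveringMapOn.of_isLocalHomeomorphOn
    (f.isBranchedCovering.1.iterate 1) (f.iterate_isLocalHomeomorphOn 1)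
  exact (h.mono (f.preimage_iterate_M_subset n)).isCoveringMap_restrictPreimage

theorem pathConnectedSpace_M : PathConnectedSpace f.M :=
  isPathConnected_iff_pathConnectedSpace.1
    (isPathConnected_compl_of_finite_sphere f.finite_postCriticalSet)

theorem monodromy_apply (t : f.M) (γ : FundamentalGroup f.M t) (v : f.Vertex t) :
    f.monodromy t γ v = ⟨v.1, (f.iter_isCoveringMap v.1).monodromy γ v.2⟩ := rfl

theorem mem_ker_monodromy_iff (t : f.M) (γ : FundamentalGroup f.M t) :
    γ ∈ (f.monodromy t).ker ↔
      ∀ n, (f.iter_isCoveringMap n).monodromyFunctor.map γ = 𝟙 _ := by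
  rw [MonoidHom.mem_ker]
  constructor
  · intro h n
    refine ConcreteCategory.hom_ext _ _ fun x => ?_
    have := congrArg (fun e : Equiv.Perm (f.Vertex t) => e ⟨n, x⟩) h
    exact eq_of_heq (Sigma.mk.inj this).2
  · intro h
    ext1 ⟨n, x⟩
    rw [monodromy_apply]
    exact congrArg (Sigma.mk n) (ConcreteCategory.congr_hom (h n) x)

/-- The iterated monodromy group does not depend on the base point. -/
theorem nonempty_IMG_mulEquiv (t s : f.M) : Nonempty (f.IMG t ≃* f.IMG s) := by
  have := f.pathConnectedSpace_M
  let α : FundamentalGroupoid.mk t ≅ FundamentalGroupoid.mk s :=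
    (Groupoid.isoEquivHom ..).symm ⟦PathConnectedSpace.somePath t s⟧
  refine ⟨QuotientGroup.congr _ _ (α.conj : FundamentalGroup f.M t ≃* FundamentalGroup f.M s) ?_⟩
  rw [Subgroup.map_equiv_eq_comap_symm]
  ext γ
  rw [Subgroup.mem_comap]
  obtain ⟨δ, rfl⟩ := α.conj.surjective γ
  refine Iff.trans (b := δ ∈ (f.monodromy t).ker) ?_ ?_
  · exact iff_of_eq (congrArg (· ∈ (f.monodromy t).ker) (α.conj.symm_apply_apply δ))
  rw [mem_ker_monodromy_iff, mem_ker_monodromy_iff]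
  refine forall_congr' fun n => ?_
  -- The monodromy functor turns conjugation by `α` into conjugation by its image, which detects
  -- triviality.
  rw [Functor.map_conj]
  let F := (f.iter_isCoveringMap n).monodromyFunctor
  exact (map_eq_one_iff (F.mapIso α).conj (F.mapIso α).conj.injective).symm

end PCFBranchedCovering

/-! ### Lifting the isotopy level by level -/

/-- A homotopy `f⁻ⁿ(M_f) → g⁻ⁿ(M_g)` with bijective ends, such that the final map lies over the
initial map. -/
structure LevelHomotopy (f g : PCFBranchedCovering) (n : ℕ) where
  toMap : C(unitInterval × (f^[n] ⁻¹' f.M), g^[n] ⁻¹' g.M)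
  bijective_zero : Function.Bijective fun x => toMap (0, x)
  bijective_one : Function.Bijective fun x => toMap (1, x)
  mem_of_mem : ∀ x : f^[n] ⁻¹' f.M,
    (toMap (1, x) : S2) ∈ g^[n + 1] ⁻¹' g.M → (x : S2) ∈ f^[n + 1] ⁻¹' f.M
  comp_one : ∀ x : f^[n + 1] ⁻¹' f.M,
    g (toMap (1, f.incl n x)) = (toMap (0, f.levelMap n x) : S2)

namespace LevelHomotopy

variable {f g : PCFBranchedCovering} {n : ℕ}

/-- The final map of a level homotopy, on the next level. -/
def final (L : LevelHomotopy f g n) : C(f^[n + 1] ⁻¹' f.M, g^[n + 1] ⁻¹' g.M) where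
  toFun x := ⟨L.toMap (1, f.incl n x), by
    change g (L.toMap (1, f.incl n x)) ∈ g^[n] ⁻¹' g.M
    rw [L.comp_one]
    exact Subtype.coe_prop _⟩
  continuous_toFun := by fun_prop

theorem levelMap_final (L : LevelHomotopy f g n) (x : f^[n + 1] ⁻¹' f.M) :
    g.levelMap n (L.final x) = L.toMap (0, f.levelMap n x) :=
  Subtype.ext (L.comp_one x)

/-- Surjectivity is what `mem_of_mem` is for: a preimage under the final map of a point of the next
level is itself in the next level. -/
theorem final_bijective (L : LevelHomotopy f g n) : Function.Bijective L.final := by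
  constructor
  · intro x y hxy
    have hxy' : L.toMap (1, f.incl n x) = L.toMap (1, f.incl n y) :=
      Subtype.ext (Subtype.mk.inj hxy)
    exact Subtype.ext (Subtype.mk.inj (L.bijective_one.1 hxy'))
  · intro z
    obtain ⟨x, hx⟩ := L.bijective_one.2 (g.incl n z)
    have hx' : (L.toMap (1, x) : S2) = z := congrArg Subtype.val hx
    exact ⟨⟨x, L.mem_of_mem x (hx' ▸ z.2)⟩, Subtype.ext hx'⟩

/-- A level homotopy lifts to the next level. -/
theorem exists_lift (L : LevelHomotopy f g n) : ∃ L' : LevelHomotopy f g (n + 1),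
    ∀ x, g.levelMap n (L'.toMap (0, x)) = L.toMap (0, f.levelMap n x) := by
  have cov := g.levelMap_isCoveringMap n
  obtain ⟨K, hK, hK0⟩ : ∃ K : C(unitInterval × (f^[n + 1] ⁻¹' f.M), g^[n + 1] ⁻¹' g.M),
      (∀ s x, g.levelMap n (K (s, x)) = L.toMap (s, f.levelMap n x)) ∧
        ∀ x, K (0, x) = L.final x := by
    let H := L.toMap.comp ((ContinuousMap.id unitInterval).prodMap (f.levelMap n))
    have H_0 : ∀ x, H (0, x) = g.levelMap n (L.final x) := fun x => (L.levelMap_final x).symm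
    exact ⟨cov.liftHomotopy H L.final H_0,
      fun s x => congrFun (cov.liftHomotopy_lifts H L.final H_0) (s, x),
      cov.liftHomotopy_zero H L.final H_0⟩
  have hcont (x) : Continuous fun s => K (s, x) := by fun_prop
  refine ⟨⟨K, ?_, ⟨?_, ?_⟩, ?_, ?_⟩, fun x => ?_⟩
  · simpa only [hK0] using L.final_bijective
  · intro x y hxy
    have hf : f.levelMap n x = f.levelMap n y := L.bijective_one.1 <| by
      simpa only [hK] using congrArg (g.levelMap n) hxy
    -- Both paths lift the same path and agree at time 1, so they also agree at time 0.
    have h : (fun s => K (s, x)) = fun s => K (s, y) :=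
      cov.eq_of_comp_eq (hcont x) (hcont y) (funext fun s => by
        rw [Function.comp_apply, Function.comp_apply, hK, hK, hf]) 1 hxy
    exact L.final_bijective.1 (by simpa only [hK0] using congrFun h 0)
  · intro z
    obtain ⟨w, hw⟩ := L.bijective_one.2 (g.levelMap n z)
    -- Lifting backwards from `z` finds the starting point of the track of `K` that ends at `z`.
    obtain ⟨Γ, hΓ, hΓ1⟩ := cov.exists_path_lifts_of_one
      (L.toMap.comp ((ContinuousMap.id unitInterval).prodMk (.const _ w))) z hw
    have hΓ' (s) : g.levelMap n (Γ s) = L.toMap (s, w) := congrFun hΓ s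
    obtain ⟨x, hx⟩ := L.final_bijective.2 (Γ 0)
    have hw' : f.levelMap n x = w := L.bijective_zero.1 <| by
      change L.toMap (0, _) = L.toMap (0, w)
      rw [← hΓ', ← hx, L.levelMap_final]
    have h : (fun s => K (s, x)) = Γ :=
      cov.eq_of_comp_eq (hcont x) Γ.continuous (funext fun s => by
        rw [Function.comp_apply, Function.comp_apply, hK, hΓ', hw']) 0
        ((hK0 x).trans hx)
    exact ⟨x, (congrFun h 1).trans hΓ1⟩
  · intro x hx
    refine L.mem_of_mem (f.levelMap n x) ?_
    rw [← hK]
    exact hx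
  · intro x
    rw [hK0]
    exact congrArg Subtype.val (hK 1 (f.incl (n + 1) x))
  · rw [← L.levelMap_final, ← hK0]

end LevelHomotopy

/-! ### Consequences of a combinatorial equivalence -/

namespace IsCombinatorialEquivalence

variable {f g : PCFBranchedCovering} {ψ₀ ψ₁ : S2 ≃ₜ S2}

/-- The isotopy of a combinatorial equivalence restricts to a level homotopy between the
complements of the post-critical sets. -/
theorem exists_levelHomotopy_zero (h : IsCombinatorialEquivalence f g ψ₀ ψ₁) :
    ∃ L : LevelHomotopy f g 0, ∀ x, (L.toMap (0, x) : S2) = ψ₀ x := by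
  obtain ⟨H, hH⟩ := h.isotopic
  have hP (s) (x : S2) : H (s, x) ∈ g.P ↔ x ∈ f.P := by
    constructor
    · rw [← h.image₀]
      rintro ⟨y, hy, hyx⟩
      -- The isotopy is constant in time on `P_f`, and each of its stages is injective.
      have : H (s, y) = H (s, x) := (H.eq_fst s hy).trans hyx
      exact (hH s).injective this ▸ hy
    · intro hx
      rw [H.eq_fst s hx, ← h.image₀]
      exact Set.mem_image_of_mem _ hx
  let K : C(unitInterval × (f^[0] ⁻¹' f.M), g^[0] ⁻¹' g.M) :=
    { toFun := fun p => ⟨H (p.1, p.2), fun hp => p.2.2 ((hP _ _).1 hp)⟩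
      continuous_toFun := by fun_prop }
  have hK (s) : Function.Bijective fun x => K (s, x) := by
    constructor
    · intro x y hxy
      exact Subtype.ext ((hH s).injective (congrArg Subtype.val hxy))
    · intro z
      obtain ⟨x, hx⟩ := (hH s).surjective z
      exact ⟨⟨x, fun hxP => z.2 (hx ▸ (hP s x).2 hxP)⟩, Subtype.ext hx⟩
  have hK0 (x) : (K (0, x) : S2) = ψ₀ x := H.apply_zero x
  have hK1 (x) : (K (1, x) : S2) = ψ₁ x := H.apply_one x
  have hcomp (x) : g (ψ₁ x) = ψ₀ (f x) := (congrFun h.comp_eq x).symm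
  refine ⟨⟨K, hK 0, hK 1, fun x hx hxP => hx ?_, fun x => ?_⟩, hK0⟩
  · change g (K (1, x)) ∈ g.P
    rw [hK1, hcomp, ← h.image₀]
    exact Set.mem_image_of_mem _ hxP
  · rw [hK0, hK1]
    exact hcomp x

/-- A compatible family of bijections `f⁻ⁿ(M_f) → g⁻ⁿ(M_g)` over `ψ₀`. -/
theorem exists_levelMaps (h : IsCombinatorialEquivalence f g ψ₀ ψ₁) :
    ∃ θ : ∀ n, C(f^[n] ⁻¹' f.M, g^[n] ⁻¹' g.M), (∀ n, Function.Bijective (θ n)) ∧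
      (∀ x, (θ 0 x : S2) = ψ₀ x) ∧
      ∀ n x, g.levelMap n (θ (n + 1) x) = θ n (f.levelMap n x) := by
  obtain ⟨L₀, hL₀⟩ := h.exists_levelHomotopy_zero
  choose next hnext using fun n (L : LevelHomotopy f g n) => L.exists_lift
  let L : ∀ n, LevelHomotopy f g n := fun n => Nat.rec L₀ next n
  exact ⟨fun n => ⟨fun x => (L n).toMap (0, x), by fun_prop⟩, fun n => (L n).bijective_zero, hL₀,
    fun n => hnext n (L n)⟩

theorem pushForward_bijective (h : IsCombinatorialEquivalence f g ψ₀ ψ₁) (t : f.M) :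
    Function.Bijective (pushForward ψ₀ h.image₀ t) := by
  let φ : f.M ≃ₜ g.M := ψ₀.sets (by
    rw [Set.preimage_compl, ← h.image₀, Set.preimage_image_eq _ ψ₀.injective])
  exact φ.bijective_path_homotopic_map t t

/-- The isomorphism of trees of preimages induced by a combinatorial equivalence. -/
theorem exists_treeIso (h : IsCombinatorialEquivalence f g ψ₀ ψ₁) (t : f.M) :
    ∃ τ : TreeIso f g t (restrict ψ₀ h.image₀ t),
      ∀ (γ : FundamentalGroup f.M t) (v : f.Vertex t),
        g.monodromy (restrict ψ₀ h.image₀ t) (pushForward ψ₀ h.image₀ t γ) (τ.toEquiv v) =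
          τ.toEquiv (f.monodromy t γ v) := by
  obtain ⟨θ, hθ, hθ0, hstep⟩ := h.exists_levelMaps
  have hiter (n) : ∀ x, g.iter n (θ n x) = restrict ψ₀ h.image₀ (f.iter n x) := by
    induction n with
    | zero => exact fun x => Subtype.ext (hθ0 x)
    | succ n ih =>
      intro x
      -- `f^[n + 1]` applies `f` first, so `iter (n + 1)` is definitionally `iter n` after `levelMap
      -- n`.
      exact (congrArg (g.iter n) (hstep n x)).trans (ih (f.levelMap n x))
  have hinj : Function.Injective (restrict ψ₀ h.image₀) := fun x y hxy =>
    Subtype.ext (ψ₀.injective (congrArg Subtype.val hxy))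
  let e : f.Vertex t ≃ g.Vertex (restrict ψ₀ h.image₀ t) :=
    Equiv.sigmaCongrRight fun n => (Equiv.ofBijective (θ n) (hθ n)).subtypeEquiv fun x => by
      change f.iter n x = t ↔ g.iter n (θ n x) = restrict ψ₀ h.image₀ t
      rw [hiter, hinj.eq_iff]
  have hparent (v w : f.Vertex t) : (e v).IsParent (e w) ↔ v.IsParent w := by
    obtain ⟨n, v⟩ := v
    obtain ⟨m, w⟩ := w
    refine and_congr_right fun hm => ?_
    obtain rfl : m = n + 1 := hm
    change g (θ (n + 1) w.1) = θ n v.1 ↔ f w.1 = v.1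
    have hw : g (θ (n + 1) w.1) = θ n (f.levelMap n w.1) := congrArg Subtype.val (hstep n w.1)
    rw [hw, Subtype.coe_inj, (hθ n).1.eq_iff]
    exact Subtype.ext_iff
  refine ⟨⟨⟨e, or_congr (hparent _ _) (hparent _ _)⟩, fun v => rfl⟩, fun γ v => ?_⟩
  obtain ⟨n, v⟩ := v
  exact congrArg (Sigma.mk n) (Subtype.ext ((f.iter_isCoveringMap n).monodromy_naturality
    (g.iter_isCoveringMap n) (θ n) (restrict ψ₀ h.image₀) (hiter n) γ v))

theorem map_ker_monodromy (h : IsCombinatorialEquivalence f g ψ₀ ψ₁) (t : f.M) :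
    (f.monodromy t).ker.map (pushForward ψ₀ h.image₀ t) =
      (g.monodromy (restrict ψ₀ h.image₀ t)).ker := by
  obtain ⟨τ, hτ⟩ := h.exists_treeIso t
  have hker : (f.monodromy t).ker =
      (g.monodromy (restrict ψ₀ h.image₀ t)).ker.comap (pushForward ψ₀ h.image₀ t) := by
    -- Conjugation by `τ` preserves and reflects triviality of the action.
    ext γ
    rw [Subgroup.mem_comap, MonoidHom.mem_ker, MonoidHom.mem_ker, Equiv.ext_iff, Equiv.ext_iff,
      ← τ.toEquiv.forall_congr_right]
    simp only [hτ, Equiv.Perm.one_apply, EmbeddingLike.apply_eq_iff_eq]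
  rw [hker, Subgroup.map_comap_eq_self_of_surjective (h.pushForward_bijective t).2]

theorem exists_IMG_mulEquiv (h : IsCombinatorialEquivalence f g ψ₀ ψ₁) (t : f.M) :
    ∃ e : f.IMG t ≃* g.IMG (restrict ψ₀ h.image₀ t), ∀ γ : FundamentalGroup f.M t,
      e (QuotientGroup.mk γ) = QuotientGroup.mk (pushForward ψ₀ h.image₀ t γ) :=
  ⟨QuotientGroup.congr _ _ (MulEquiv.ofBijective _ (h.pushForward_bijective t))
    (h.map_ker_monodromy t), fun _ => rfl⟩

end IsCombinatorialEquivalence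

end ThurstonMap

theorem mainTheorem3 (f g : ThurstonMap.PCFBranchedCovering)
    (ψ₀ ψ₁ : ThurstonMap.S2 ≃ₜ ThurstonMap.S2)
    (h : ThurstonMap.IsCombinatorialEquivalence f g ψ₀ ψ₁) :
    (∀ t : f.M,
      -- the kernels of the monodromy actions correspond under the isomorphism `(ψ₀)_⋆`
      Function.Bijective (ThurstonMap.pushForward ψ₀ h.image₀ t) ∧
      (f.monodromy t).ker.map (ThurstonMap.pushForward ψ₀ h.image₀ t) =
        (g.monodromy (ThurstonMap.restrict ψ₀ h.image₀ t)).ker ∧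
      -- `(ψ₀)_⋆` induces an isomorphism from `IMG(f, t)` onto `IMG(g, ψ₀(t))`
      (∃ e : f.IMG t ≃* g.IMG (ThurstonMap.restrict ψ₀ h.image₀ t),
        ∀ γ : FundamentalGroup f.M t,
          e (QuotientGroup.mk γ) = QuotientGroup.mk (ThurstonMap.pushForward ψ₀ h.image₀ t γ)) ∧
      -- one isomorphism of the trees of preimages conjugates the two monodromy actions
      (∃ τ : ThurstonMap.TreeIso f g t (ThurstonMap.restrict ψ₀ h.image₀ t),
        ∀ (γ : FundamentalGroup f.M t) (v : f.Vertex t),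
          g.monodromy (ThurstonMap.restrict ψ₀ h.image₀ t)
              (ThurstonMap.pushForward ψ₀ h.image₀ t γ) (τ.toEquiv v) =
            τ.toEquiv (f.monodromy t γ v))) ∧
    -- the iterated monodromy group is an invariant of the combinatorial equivalence class
    (∀ (t : f.M) (s : g.M), Nonempty (f.IMG t ≃* g.IMG s)) := by 
  refine ⟨fun t => ⟨h.pushForward_bijective t, h.map_ker_monodromy t, h.exists_IMG_mulEquiv t,
    h.exists_treeIso t⟩, fun t s => ?_⟩
  obtain ⟨e, -⟩ := h.exists_IMG_mulEquiv t
  obtain ⟨e'⟩ := g.nonempty_IMG_mulEquiv (ThurstonMap.restrict ψ₀ h.image₀ t) s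
  exact ⟨e.trans e'⟩
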